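/- Let $K_{k+1}$ be the complete graph with non-sink vertices $v_1,\dots,v_k$ and sink $s$. A sandpile on $K_{k+1}$ is a function $c:\{v_1,\dots,v_k\}\to\mathbb{Z}_{\ge 0}$. A vertex $v_i$ with $c(v_i)\ge k$ is unstable and may topple, which removes $k$ grains from $v_i$ and adds one grain to every other non-sink vertex; $c$ is stable if no vertex is unstable. Every sandpile $a$ can be turned into a unique stable sandpile $a^\circ$ by toppling unstable vertices, and the number of times each vertex topples does not depend on the order. A stable sandpile $c$ is recurrent if for every sandpile $a$ there is a sandpile $b$ with $(a+b)^\circ=c$; let $\mathscr{S}(K_{k+1})$ be the set of recurrent sandpiles. Let $n\ge 0$. For $c\in\mathscr{S}(K_{n+1})$ and a non-sink vertex $v$, the principal avalanche of $c$ at $v$ is the stabilization of $c+1_v$; let $\nu(c,v)=(f_1,\dots,f_n)$, where $f_i$ is the number of times $v_i$ topples in it. Its size is $f_1+\dots+f_n$. Let $\lambda_m$ be the number of pairs $(c,v)$ whose principal avalanche has size $m$, and let $\mathscr{A}_{K_{n+1}}(x_1,\dots,x_n)=\sum_{c\in\mathscr{S}(K_{n+1})}\sum_{v}\prod_{i=1}^n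 x_i^{\nu(c,v)_i}$ be the multivariate avalanche polynomial. Then $$\mathscr{A}_{K_{n+1}}(x_1,\dots,x_n)=\sum_{m=0}^n\frac{\lambda_m}{\binom nm}\,e_m(x_1,\dots,x_n),$$ where $e_m$ is the $m$-th elementary symmetric polynomial. Moreover, for every $1\le m\le n$ the following hold. (a) There is a well-defined bijection $\phi$ from the set of pairs $(c,v)$ whose principal avalanche has size $m$ onto the set of tuples $(v,J,c_1,c_2)$, where $v$ is a non-sink vertex of $K_{n+1}$, $J$ is a set of $m-1$ non-sink vertices different from $v$, $c_1\in\mathscr{S}(K_m)$ and $c_2\in\mathscr{S}(K_{n-m+1})$. It is given by $\phi(c,v)=(v,J,c_1,c_2)$, where $J$ is the set of vertices other than $v$ that topple in the principal avalanche of $c$ at $v$, $c_1$ is the list of the values $c(w)-(n-m+1)$ for $w\in J$, and $c_2$ is the list of the values $c(w)$ for the non-sink vertices $w\notin J\cup\{v\}$, both in increasing order of the index of $w$. (b) $$\lambda_m=\binom nm\, m^{m-1}(n-m+1)^{n-m-1}.$$ -/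

import Mathlib

/-- A finite connected undirected multigraph without loops, with a distinguished sink.
The non-sink vertices are the elements of `W`, the vertex set is `Option W`, and the sink is
`none`. `weight u v` is the number of edges between `u` and `v`. -/
structure SinkGraph (W : Type*) where
  weight : Option W → Option W → ℕ
  weight_symm : ∀ u v, weight u v = weight v u
  weight_self : ∀ u, weight u u = 0
  connected : (SimpleGraph.fromRel fun u v => 0 < weight u v).Connected

namespace SinkGraph

variable {W : Type*} [Fintype W] [DecidableEq W] (G : SinkGraph W)

/-- The degree of a non-sink vertex (edges to the sink are counted). -/
def deg (v : W) : ℕ := ∑ u : Option W, G.weight (some v) u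

/-- A sandpile `c : W → ℕ` is stable if `c v < d_v` for every non-sink vertex `v`. -/
def IsStable (c : W → ℕ) : Prop := ∀ v, c v < G.deg v

/-- The sandpile obtained from `c` by toppling `v` (used only when `d_v ≤ c v`). -/
def topple (c : W → ℕ) (v : W) : W → ℕ :=
  fun w => if w = v then c v - G.deg v else c w + G.weight (some v) (some w)

/-- `G.Topples c l c'`: starting from `c` one may topple successively the vertices in the list
`l`, each of them being unstable when it topples, and the result is `c'`. -/
inductive Topples : (W → ℕ) → List W → (W → ℕ) → Prop
  | nil (c : W → ℕ) : Topples c [] c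
  | cons {c c' : W → ℕ} {v : W} {l : List W} (hv : G.deg v ≤ c v)
      (h : Topples (G.topple c v) l c') : Topples c (v :: l) c'

/-- `c'` is the stabilization of `c`. -/
def Stabilizes (c c' : W → ℕ) : Prop := (∃ l, G.Topples c l c') ∧ G.IsStable c'

/-- `f` records how often each vertex topples in a stabilization of `c`. -/
def IsTopplingVector (c f : W → ℕ) : Prop :=
  ∃ l c', G.Topples c l c' ∧ G.IsStable c' ∧ ∀ w, f w = l.count w

/-- A sandpile `c` is recurrent if it is stable and for every sandpile `a` there is a
sandpile `b` such that `a + b` stabilizes to `c`. -/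
def IsRecurrent (c : W → ℕ) : Prop :=
  G.IsStable c ∧ ∀ a : W → ℕ, ∃ b : W → ℕ, G.Stabilizes (a + b) c

/-! ### Existence and uniqueness of the toppling vector of a stabilization -/

theorem topple_unstable {c : W → ℕ} {u v : W} (h : u ≠ v) (hv : G.deg v ≤ c v) :
    G.deg v ≤ G.topple c u v := by
  simp only [topple, if_neg h.symm]
  omega

theorem topple_comm {c : W → ℕ} {u v : W} (h : u ≠ v) (hu : G.deg u ≤ c u)
    (hv : G.deg v ≤ c v) : G.topple (G.topple c u) v = G.topple (G.topple c v) u := by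
  funext w
  by_cases h1 : w = u
  · subst h1
    simp only [topple, if_neg h, if_neg h.symm, if_true]
    omega
  · by_cases h2 : w = v
    · subst h2
      simp only [topple, if_neg h.symm, if_true]
      omega
    · simp only [topple, if_neg h1, if_neg h2]
      omega

theorem le_of_topples {c c' : W → ℕ} {l : List W} {v : W} (h : G.Topples c l c')
    (hv : v ∉ l) : c v ≤ c' v := by
  induction h with
  | nil c => exact le_rfl
  | @cons c c' u l hu h ih =>
    rw [List.mem_cons, not_or] at hv
    refine le_trans ?_ (ih hv.2)
    simp only [topple, if_neg hv.1]
    omega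

theorem topples_erase {c c' : W → ℕ} {l : List W} {v : W} (h : G.Topples c l c')
    (hv : v ∈ l) (hc : G.deg v ≤ c v) : G.Topples (G.topple c v) (l.erase v) c' := by
  induction h with
  | nil c => simp at hv
  | @cons c c' u l hu h ih =>
    by_cases huv : u = v
    · subst huv
      simpa using h
    · rw [List.erase_cons_tail (by simpa using huv)]
      have hvl : v ∈ l := by
        rcases List.mem_cons.1 hv with h' | h'
        · exact absurd h'.symm huv
        · exact h'
      refine Topples.cons (G.topple_unstable (Ne.symm huv) hu) ?_
      rw [← G.topple_comm huv hu hc]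
      exact ih hvl (G.topple_unstable huv hc)

theorem topples_count_le {c c₁ c₂ : W → ℕ} {l l' : List W} (h : G.Topples c l c₁)
    (h' : G.Topples c l' c₂) (hs : G.IsStable c₂) (w : W) : l.count w ≤ l'.count w := by
  induction h generalizing l' with
  | nil c => simp
  | @cons c c₁ v l hv h ih =>
    have hm : v ∈ l' := by
      by_contra hn
      exact absurd (hs v) (not_lt.2 (hv.trans (G.le_of_topples h' hn)))
    have := ih (G.topples_erase h' hm hv)
    rw [(List.perm_cons_erase hm).count_eq w, List.count_cons, List.count_cons]
    omega

/-- A potential on the vertices which strictly decreases in the mean under each toppling. -/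
theorem exists_potential : ∃ h : W → ℤ, (∀ v, 0 ≤ h v) ∧
    ∀ v, ∑ w : W, (G.weight (some v) (some w) : ℤ) * h w < G.deg v * h v := by
  classical
  let S := SimpleGraph.fromRel fun u v => 0 < G.weight u v
  let d : Option W → ℕ := fun u => S.dist u none
  let D : ℕ := ∑ u : Option W, d u
  let B : ℤ := 1 + ∑ v : W, (G.deg v : ℤ)
  have hB : 1 ≤ B := by
    have : (0 : ℤ) ≤ ∑ v : W, (G.deg v : ℤ) := Finset.sum_nonneg fun _ _ => by positivity
    simp only [B]
    omega
  have hd : ∀ u, d u ≤ D := fun u =>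
    Finset.single_le_sum (f := d) (fun _ _ => Nat.zero_le _) (Finset.mem_univ u)
  let g : Option W → ℤ := fun u => B ^ (D - d u)
  have hg : ∀ u, 0 ≤ g u := fun u => by positivity
  refine ⟨fun w => B ^ D - g (some w), fun v => ?_, fun v => ?_⟩
  · exact sub_nonneg.2 (pow_le_pow_right₀ hB (Nat.sub_le _ _))
  · have key : (G.deg v : ℤ) * g (some v) < ∑ u : Option W, (G.weight (some v) u : ℤ) * g u := by
      obtain ⟨p, hp⟩ := G.connected.exists_walk_length_eq_dist (some v) none
      cases p with
      | @cons _ u _ hadj q =>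
        have hdu : d u + 1 ≤ d (some v) := by
          have h1 : d u ≤ q.length := SimpleGraph.dist_le q
          have h2 : q.length + 1 = d (some v) := hp
          omega
        have hw : 1 ≤ G.weight (some v) u := by
          rw [SimpleGraph.fromRel_adj] at hadj
          rcases hadj.2 with h | h
          · exact h
          · rw [G.weight_symm]
            exact h
        have h3 : B * g (some v) ≤ g u := by
          have : B * g (some v) = B ^ (D - d (some v) + 1) := by
            simp only [g]
            ring
          rw [this]
          refine pow_le_pow_right₀ hB ?_
          have := hd (some v)
          omega
        have h4 : (G.weight (some v) u : ℤ) * g u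
            ≤ ∑ u : Option W, (G.weight (some v) u : ℤ) * g u :=
          Finset.single_le_sum (f := fun u => (G.weight (some v) u : ℤ) * g u)
            (fun i _ => mul_nonneg (by positivity) (hg i)) (Finset.mem_univ u)
        have h5 : (G.deg v : ℤ) < B := by
          have : (G.deg v : ℤ) ≤ ∑ v : W, (G.deg v : ℤ) :=
            Finset.single_le_sum (f := fun v => (G.deg v : ℤ)) (fun _ _ => by positivity)
              (Finset.mem_univ v)
          simp only [B]
          omega
        have h6 : 0 < g (some v) := by positivity
        have h7 : g u ≤ (G.weight (some v) u : ℤ) * g u :=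
          le_mul_of_one_le_left (hg u) (by exact_mod_cast hw)
        calc (G.deg v : ℤ) * g (some v) < B * g (some v) := mul_lt_mul_of_pos_right h5 h6
          _ ≤ _ := h3.trans (h7.trans h4)
    have hnone : g none = B ^ D := by
      have : d none = 0 := SimpleGraph.dist_self
      simp only [g, this, Nat.sub_zero]
    have hdeg : (G.deg v : ℤ) = G.weight (some v) none
        + ∑ w : W, (G.weight (some v) (some w) : ℤ) := by
      simp [deg, Fintype.sum_option]
    rw [Fintype.sum_option, hnone] at key
    simp only [mul_sub, Finset.sum_sub_distrib, ← Finset.sum_mul]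
    have : (G.deg v : ℤ) * B ^ D = G.weight (some v) none * B ^ D
        + (∑ w : W, (G.weight (some v) (some w) : ℤ)) * B ^ D := by
      rw [hdeg]
      ring
    linarith

theorem exists_stabilizes (c : W → ℕ) : ∃ l c', G.Topples c l c' ∧ G.IsStable c' := by
  obtain ⟨h, h0, hh⟩ := G.exists_potential
  suffices H : ∀ (k : ℕ) (c : W → ℕ), ∑ w, (c w : ℤ) * h w ≤ k →
      ∃ l c', G.Topples c l c' ∧ G.IsStable c' from
    H (∑ w, (c w : ℤ) * h w).toNat c (Int.self_le_toNat _)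
  have hstep : ∀ (c : W → ℕ) (v : W), G.deg v ≤ c v →
      ∑ w, (G.topple c v w : ℤ) * h w < ∑ w, (c w : ℤ) * h w := by
    intro c v hv
    have e : ∀ w, (G.topple c v w : ℤ) * h w = (c w : ℤ) * h w
        + (G.weight (some v) (some w) : ℤ) * h w
        - (if w = v then (G.deg v : ℤ) * h v else 0) := by
      intro w
      by_cases hw : w = v
      · subst hw
        simp only [topple, if_true, G.weight_self, Nat.cast_sub hv]
        push_cast
        ring
      · simp only [topple, if_neg hw]
        push_cast
        ring
    rw [Finset.sum_congr rfl fun w _ => e w, Finset.sum_sub_distrib, Finset.sum_add_distrib,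
      Finset.sum_ite_eq' Finset.univ v, if_pos (Finset.mem_univ v)]
    have := hh v
    linarith
  intro k
  induction k with
  | zero =>
    intro c hc
    refine ⟨[], c, Topples.nil c, fun v => ?_⟩
    by_contra hv
    have h1 := hstep c v (not_lt.1 hv)
    have h2 : (0 : ℤ) ≤ ∑ w, (G.topple c v w : ℤ) * h w :=
      Finset.sum_nonneg fun w _ => mul_nonneg (by positivity) (h0 w)
    push_cast at hc
    omega
  | succ k ih =>
    intro c hc
    by_cases hs : G.IsStable c
    · exact ⟨[], c, Topples.nil c, hs⟩
    · simp only [IsStable, not_forall, not_lt] at hs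
      obtain ⟨v, hv⟩ := hs
      have h1 := hstep c v hv
      obtain ⟨l, c', hl, hc'⟩ := ih (G.topple c v) (by push_cast at hc; omega)
      exact ⟨v :: l, c', Topples.cons hv hl, hc'⟩

theorem existsUnique_topplingVector (c : W → ℕ) : ∃! f, G.IsTopplingVector c f := by
  obtain ⟨l, c', hl, hc'⟩ := G.exists_stabilizes c
  refine ⟨fun w => l.count w, ⟨l, c', hl, hc', fun _ => rfl⟩, ?_⟩
  rintro f ⟨l', c'', hl', hc'', hf⟩
  funext w
  rw [hf]
  exact le_antisymm (G.topples_count_le hl' hl hc' w) (G.topples_count_le hl hl' hc'' w)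

/-! ### Avalanche polynomials -/

/-- The toppling vector of the stabilization of `c`. -/
noncomputable def topplingVector (c : W → ℕ) : W → ℕ :=
  (G.existsUnique_topplingVector c).choose

/-- The toppling vector `ν(c, v)` of the stabilization of `c + 1_v`. -/
noncomputable def nu (c : W → ℕ) (v : W) : W → ℕ := G.topplingVector (c + Pi.single v 1)

open Classical in
/-- The finite set of recurrent sandpiles (recurrent sandpiles are stable). -/
noncomputable def recurrents : Finset (W → ℕ) :=
  (Fintype.piFinset fun v => Finset.range (G.deg v)).filter fun c => G.IsRecurrent c

theorem mem_recurrents {c : W → ℕ} : c ∈ G.recurrents ↔ G.IsRecurrent c := by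
  simp only [recurrents, Finset.mem_filter, Fintype.mem_piFinset, Finset.mem_range,
    and_iff_right_iff_imp]
  exact fun h => h.1

/-- The multivariate avalanche polynomial, with rational coefficients: the sum of all
avalanche monomials `x ^ ν(c, v)`, for `c` recurrent and `v` a non-sink vertex. -/
noncomputable def avalanchePolynomial : MvPolynomial W ℚ :=
  ∑ c ∈ G.recurrents, ∑ v : W, ∏ i : W, MvPolynomial.X i ^ G.nu c v i

/-- The size of the principal avalanche of `c` at `v`: the length of the toppling sequence. -/
noncomputable def avalancheSize (c : W → ℕ) (v : W) : ℕ := ∑ i : W, G.nu c v i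

/-- The principal avalanches of size `m`, given by pairs `(c, v)` of a recurrent sandpile and
a non-sink vertex. -/
noncomputable def avalanches (m : ℕ) : Finset ((W → ℕ) × W) :=
  (G.recurrents ×ˢ Finset.univ).filter fun p => G.avalancheSize p.1 p.2 = m

/-- The number `λ_m` of principal avalanches of size `m`. -/
noncomputable def avalancheCount (m : ℕ) : ℕ := (G.avalanches m).card

end SinkGraph

/-- The complete graph `K_{k+1}` with non-sink vertices `v_1, …, v_k` (indexed by `Fin k`). -/
def completeSink (k : ℕ) : SinkGraph (Fin k) where
  weight u v := if u = v then 0 else 1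
  weight_symm u v := by simp only [eq_comm]
  weight_self u := if_pos rfl
  connected := by
    have : (SimpleGraph.fromRel fun u v : Option (Fin k) => 0 < if u = v then 0 else 1) = ⊤ := by
      ext u v
      by_cases h : u = v <;> simp [h]
    rw [this]
    exact SimpleGraph.connected_top

/-- The tuples `(v, J, c₁, c₂)`: a non-sink vertex `v` of `K_{n+1}`, a set `J` of `m - 1`
non-sink vertices different from `v`, a recurrent sandpile `c₁` on `K_m` and a recurrent
sandpile `c₂` on `K_{n-m+1}`. -/
structure AvalancheTuple (n m : ℕ) where
  v : Fin n
  J : Finset (Fin n)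
  notMem : v ∉ J
  card_J : J.card + 1 = m
  c₁ : Fin (m - 1) → ℕ
  c₂ : Fin (n - m) → ℕ
  rec₁ : (completeSink (m - 1)).IsRecurrent c₁
  rec₂ : (completeSink (n - m)).IsRecurrent c₂

namespace AvalancheTuple

variable {n m : ℕ} (t : AvalancheTuple n m)

theorem card_J_eq : t.J.card = m - 1 := by
  have := t.card_J
  omega

theorem card_compl : (insert t.v t.J)ᶜ.card = n - m := by
  rw [Finset.card_compl, Finset.card_insert_of_notMem t.notMem, t.card_J, Fintype.card_fin]

/-- `t = φ(c, v)`: the first entry is `v`; `J` is the set of the vertices other than `v` which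
topple in the principal avalanche of `c` at `v`; `c₁` consists of the values
`c(w) - (n - m + 1)` for `w ∈ J`, and `c₂` of the values `c(w)` for `w ∉ J ∪ {v}`, both listed
in increasing order of the index of `w`. -/
def IsPhi (c : Fin n → ℕ) (v : Fin n) : Prop :=
  t.v = v ∧
  t.J = Finset.univ.filter (fun w => w ≠ v ∧ 0 < (completeSink n).nu c v w) ∧
  (∀ i : Fin (m - 1), c (t.J.orderEmbOfFin t.card_J_eq i) = t.c₁ i + (n - m + 1)) ∧
  ∀ i : Fin (n - m), c ((insert t.v t.J)ᶜ.orderEmbOfFin t.card_compl i) = t.c₂ i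

end AvalancheTuple

/-!
Toppling every vertex `w` exactly `f w` times subtracts the reduced Laplacian applied to `f`, and
such a script can be carried out legally as soon as the final configuration is allowed on the
support of `f`, that is, contains no forbidden subconfiguration in the sense of Dhar: among the
vertices that topple most often there is then always an unstable one. Hence stabilizations and
recurrence (Dhar's criterion) are described by inequalities, and every class of integer
configurations modulo the Laplacian contains exactly one recurrent sandpile.

If `v` is adjacent to the sink and `c` is recurrent, every vertex topples at most once in the
principal avalanche of `c` at `v`. For the set of toppled vertices to be `insert v J` means that
`c v` is maximal, that `c`, lowered by the number of edges leaving `insert v J`, is allowed on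
`J` with `v` in the role of a sink, and that `c` is recurrent on the complement with `insert v J`
merged into the sink. On a complete graph both conditions are recurrence on a smaller complete
graph, which gives the bijection. There, two configurations are equivalent modulo the Laplacian
if they differ by a constant modulo `k + 1`, so that `K_{k+1}` has `(k + 1) ^ (k - 1)` recurrent
sandpiles.

The coefficients of the avalanche polynomial only depend on the number of toppled vertices, since
the automorphisms of a complete graph permute the non-sink vertices arbitrarily.
-/

namespace SinkGraph

open Matrix

variable {W : Type*}

/-! ### Forbidden subconfigurations -/

section Allowed

variable (G : SinkGraph W)

/-- The number of edges between the non-sink vertex `w` and the set `S`. -/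
def weightTo (w : W) (S : Finset W) : ℕ := ∑ u ∈ S, G.weight (some w) (some u)

/-- The integer configuration `z` is allowed on `T`: no nonempty `S ⊆ T` is a forbidden
subconfiguration in the sense of Dhar, that is, some `w ∈ S` satisfies `weightTo w S ≤ z w`.
Integer values are used so that the configurations resulting from a toppling script can be
considered before they are known to be nonnegative. -/
def IsAllowedOn (z : W → ℤ) (T : Finset W) : Prop :=
  ∀ S ⊆ T, S.Nonempty → ∃ w ∈ S, (G.weightTo w S : ℤ) ≤ z w

variable {G} {z z' : W → ℤ} {S T : Finset W} {w : W}

theorem weightTo_mono (h : S ⊆ T) : G.weightTo w S ≤ G.weightTo w T :=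
  Finset.sum_le_sum_of_subset h

theorem IsAllowedOn.mono (h : G.IsAllowedOn z T) (hST : S ⊆ T) : G.IsAllowedOn z S :=
  fun U hU => h U (hU.trans hST)

theorem isAllowedOn_congr (hz : ∀ w ∈ T, z w = z' w) :
    G.IsAllowedOn z T ↔ G.IsAllowedOn z' T :=
  forall₂_congr fun S hS => imp_congr_right fun _ => exists_congr fun w =>
    and_congr_right fun hw => by rw [hz w (hS hw)]

theorem IsAllowedOn.nonneg (h : G.IsAllowedOn z T) (hw : w ∈ T) : 0 ≤ z w := by
  obtain ⟨u, hu, hle⟩ := h {w} (Finset.singleton_subset_iff.2 hw) (Finset.singleton_nonempty w)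
  rw [Finset.mem_singleton.1 hu] at hle
  exact le_trans (by positivity) hle

theorem isAllowedOn_insert_iff [DecidableEq W] (hw : w ∉ T)
    (hz : ∀ u ∈ T, z u < G.weightTo u (insert w T)) :
    G.IsAllowedOn z (insert w T) ↔ G.weightTo w (insert w T) ≤ z w ∧ G.IsAllowedOn z T := by
  refine ⟨fun h => ⟨?_, h.mono (Finset.subset_insert w T)⟩, fun ⟨hle, h⟩ S hS hne => ?_⟩
  · obtain ⟨u, hu, hle⟩ := h _ subset_rfl (Finset.insert_nonempty w T)
    rcases Finset.mem_insert.1 hu with rfl | huT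
    · exact hle
    · exact absurd hle (hz u huT).not_ge
  · by_cases hwS : w ∈ S
    · exact ⟨w, hwS, (Nat.cast_le.2 (weightTo_mono hS)).trans hle⟩
    · exact h S ((Finset.subset_insert_iff_of_notMem hwS).1 hS) hne

theorem isAllowedOn_map {W' : Type*} {H : SinkGraph W'} (e : W ↪ W')
    (he : ∀ u v, H.weight (some (e u)) (some (e v)) = G.weight (some u) (some v))
    {z : W' → ℤ} {T : Finset W} :
    H.IsAllowedOn z (T.map e) ↔ G.IsAllowedOn (z ∘ e) T := by
  have hweight (S : Finset W) (w : W) : H.weightTo (e w) (S.map e) = G.weightTo w S := by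
    simp only [weightTo, Finset.sum_map, he]
  constructor
  · intro h S hS hne
    obtain ⟨_, hw, hle⟩ := h (S.map e) (Finset.map_subset_map.2 hS) hne.map
    obtain ⟨w, hwS, rfl⟩ := Finset.mem_map.1 hw
    exact ⟨w, hwS, hweight S w ▸ hle⟩
  · intro h S' hS' hne
    obtain ⟨S, hS, rfl⟩ := Finset.subset_map_iff.1 hS'
    obtain ⟨w, hwS, hle⟩ := h S hS (Finset.map_nonempty.1 hne)
    exact ⟨e w, Finset.mem_map_of_mem e hwS, (hweight S w).symm ▸ hle⟩

end Allowed

variable [Fintype W]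

theorem deg_eq_weight_sink_add (G : SinkGraph W) (w : W) :
    G.deg w = G.weight (some w) none + G.weightTo w Finset.univ :=
  Fintype.sum_option _

theorem weightTo_le_deg (G : SinkGraph W) (w : W) (S : Finset W) : G.weightTo w S ≤ G.deg w := by
  have := weightTo_mono (G := G) (w := w) S.subset_univ
  have := G.deg_eq_weight_sink_add w
  omega

theorem weightTo_lt_deg {G : SinkGraph W} {w : W} (hw : 0 < G.weight (some w) none)
    (S : Finset W) : G.weightTo w S < G.deg w := by
  have := weightTo_mono (G := G) (w := w) S.subset_univ
  have := G.deg_eq_weight_sink_add w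
  omega

variable [DecidableEq W] (G : SinkGraph W)

/-! ### Toppling scripts and the reduced Laplacian -/

/-- The reduced Laplacian of `G` (the row and the column of the sink are deleted): toppling each
vertex `v` exactly `h v` times subtracts `laplacian *ᵥ h` from a sandpile. -/
def laplacian : Matrix W W ℤ :=
  Matrix.diagonal (fun v => (G.deg v : ℤ)) -
    Matrix.of fun v w => (G.weight (some v) (some w) : ℤ)

theorem laplacian_mulVec_apply (z : W → ℤ) (w : W) :
    (G.laplacian *ᵥ z) w = G.deg w * z w - ∑ u, (G.weight (some w) (some u) : ℤ) * z u := by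
  rw [laplacian, sub_mulVec, Pi.sub_apply, mulVec_diagonal]
  rfl

theorem laplacian_mulVec_ite (T : Finset W) (w : W) :
    (G.laplacian *ᵥ fun u => if u ∈ T then 1 else 0) w =
      (if w ∈ T then (G.deg w : ℤ) else 0) - G.weightTo w T := by
  simp [laplacian_mulVec_apply, weightTo]

theorem cast_topple {c : W → ℕ} {v : W} (hv : G.deg v ≤ c v) (w : W) :
    (G.topple c v w : ℤ) = c w - G.laplacian w v := by
  by_cases hw : w = v
  · subst hw
    simp [topple, laplacian, G.weight_self, Nat.cast_sub hv]
  · simp [topple, laplacian, hw, G.weight_symm (some v)]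

variable {G} {a c c' : W → ℕ} {l l' : List W}

theorem Topples.cast_eq (h : G.Topples a l c) (w : W) :
    (c w : ℤ) = a w - (G.laplacian *ᵥ (l.count ·)) w := by
  induction h with
  | nil c => simp [laplacian_mulVec_apply]
  | @cons a c v l hv _ ih =>
    have hcount : (fun u => ((v :: l).count u : ℤ)) =
        (fun u => (l.count u : ℤ)) + Pi.single v 1 := by
      funext u
      simp [List.count_cons, Pi.single_apply, eq_comm (a := v)]
    rw [ih, G.cast_topple hv, hcount, mulVec_add, mulVec_single_one, Pi.add_apply, col_apply]
    ring

theorem Topples.add_right (h : G.Topples a l c) (d : W → ℕ) : G.Topples (a + d) l (c + d) := by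
  induction h with
  | nil c => exact .nil _
  | @cons a c v l hv _ ih =>
    have htopple : G.topple (a + d) v = G.topple a v + d := by
      funext w
      by_cases hw : w = v
      · subst hw
        simp only [topple, if_true, Pi.add_apply]
        omega
      · simp only [topple, if_neg hw, Pi.add_apply]
        omega
    exact .cons (hv.trans (Nat.le_add_right _ _)) (htopple ▸ ih)

theorem Topples.eq_of_isStable (h : G.Topples a l c) (h' : G.Topples a l' c')
    (hc : G.IsStable c) (hc' : G.IsStable c') : c = c' := by
  funext w
  have hcount : (fun u => (l.count u : ℤ)) = fun u => (l'.count u : ℤ) := funext fun u =>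
    congrArg _ (le_antisymm (G.topples_count_le h h' hc' u) (G.topples_count_le h' h hc u))
  exact Nat.cast_injective (R := ℤ) (by rw [h.cast_eq, h'.cast_eq, hcount])

/-! ### Legal toppling scripts -/

theorem Topples.weightTo_le (h : G.Topples a l c) {v : W} (hv : v ∉ l) {S : Finset W}
    (hS : S ⊆ insert v l.toFinset) : G.weightTo v S ≤ c v := by
  have hterm (u : W) (hu : u ∈ S) :
      (G.weight (some v) (some u) : ℤ) ≤ G.weight (some v) (some u) * l.count u := by
    rcases Finset.mem_insert.1 (hS hu) with rfl | hul
    · simp [G.weight_self]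
    · exact le_mul_of_one_le_right (by positivity)
        (by exact_mod_cast List.one_le_count_iff.2 (List.mem_toFinset.1 hul))
  have hbalance := h.cast_eq v
  rw [laplacian_mulVec_apply, List.count_eq_zero_of_not_mem hv] at hbalance
  suffices (G.weightTo v S : ℤ) ≤ c v by exact_mod_cast this
  calc (G.weightTo v S : ℤ) = ∑ u ∈ S, (G.weight (some v) (some u) : ℤ) := Nat.cast_sum _ _
    _ ≤ ∑ u ∈ S, (G.weight (some v) (some u) : ℤ) * l.count u := Finset.sum_le_sum hterm
    _ ≤ ∑ u, (G.weight (some v) (some u) : ℤ) * l.count u :=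
      Finset.sum_le_sum_of_subset_of_nonneg S.subset_univ fun _ _ _ => by positivity
    _ ≤ c v := by simp only [hbalance]; push_cast; linarith [(a v).cast_nonneg (α := ℤ)]

/-- In a nonempty set of toppled vertices, take the vertex whose last toppling comes first: all
the others topple after it. -/
theorem Topples.isAllowedOn (h : G.Topples a l c) : G.IsAllowedOn (c ·) l.toFinset := by
  induction h with
  | nil c => exact fun S hS hne => absurd (Finset.subset_empty.1 hS) hne.ne_empty
  | @cons a c v l _ h ih =>
    intro S hS hne
    rw [List.toFinset_cons] at hS
    by_cases hSl : S ⊆ l.toFinset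
    · exact ih S hSl hne
    · have hvS : v ∈ S := by
        by_contra hvS
        exact hSl ((Finset.subset_insert_iff_of_notMem hvS).1 hS)
      have hvl : v ∉ l := fun hvl =>
        hSl (by rwa [Finset.insert_eq_of_mem (List.mem_toFinset.2 hvl)] at hS)
      exact ⟨v, hvS, Nat.cast_le.2 (h.weightTo_le hvl hS)⟩

/-- Among the vertices which topple most often, allowedness of `c` provides one that is unstable. -/
theorem exists_unstable_of_isAllowedOn {h : W → ℕ} (hh : h ≠ 0)
    (hc : G.IsAllowedOn (c ·) {w | h w ≠ 0})
    (ha : ∀ w, (c w : ℤ) = a w - (G.laplacian *ᵥ (h ·)) w) :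
    ∃ w, h w ≠ 0 ∧ G.deg w ≤ a w := by
  obtain ⟨v, hv⟩ := Function.ne_iff.1 hh
  obtain ⟨m, -, hm⟩ := Finset.exists_max_image Finset.univ h ⟨v, Finset.mem_univ v⟩
  have hm0 : 0 < h m := (Nat.pos_of_ne_zero hv).trans_le (hm v (Finset.mem_univ v))
  let S : Finset W := {w | h w = h m}
  obtain ⟨w, hw, hle⟩ := hc S (fun u hu => by simp_all [S, hm0.ne']) ⟨m, by simp [S]⟩
  replace hw : h w = h m := by simpa [S] using hw
  have hterm (u : W) : (G.weight (some w) (some u) : ℤ) * h u ≤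
      G.weight (some w) (some u) * (h m - 1) +
        if u ∈ S then (G.weight (some w) (some u) : ℤ) else 0 := by
    have hu : (h u : ℤ) ≤ h m - 1 + if u ∈ S then 1 else 0 := by
      have := hm u (Finset.mem_univ u)
      simp only [S, Finset.mem_filter_univ]
      split_ifs <;> omega
    calc _ ≤ (G.weight (some w) (some u) : ℤ) * (h m - 1 + if u ∈ S then 1 else 0) := by gcongr
      _ = _ := by rw [mul_add, mul_ite, mul_one, mul_zero]
  have hsum : ∑ u, (G.weight (some w) (some u) : ℤ) * h u ≤
      G.weightTo w Finset.univ * (h m - 1) + G.weightTo w S := by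
    refine (Finset.sum_le_sum fun u _ => hterm u).trans_eq ?_
    simp [Finset.sum_add_distrib, Finset.sum_mul, weightTo]
  have hdeg : (G.weightTo w Finset.univ : ℤ) * (h m - 1) ≤ G.deg w * (h m - 1) :=
    mul_le_mul_of_nonneg_right (by exact_mod_cast G.weightTo_le_deg w _) (by omega)
  have hbalance := ha w
  rw [laplacian_mulVec_apply, hw] at hbalance
  refine ⟨w, hw ▸ hm0.ne', ?_⟩
  suffices (G.deg w : ℤ) ≤ a w by exact_mod_cast this
  linarith

theorem exists_topples_of_isAllowedOn {h : W → ℕ} (hc : G.IsAllowedOn (c ·) {w | h w ≠ 0})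
    (ha : ∀ w, (c w : ℤ) = a w - (G.laplacian *ᵥ (h ·)) w) :
    ∃ l, G.Topples a l c ∧ ∀ w, l.count w = h w := by
  induction hn : ∑ w, h w generalizing a h with
  | zero =>
    have hh : h = 0 := funext fun w => Finset.sum_eq_zero_iff.1 hn w (Finset.mem_univ w)
    subst hh
    have hac : c = a := funext fun w => by simpa [laplacian_mulVec_apply] using ha w
    exact ⟨[], hac ▸ .nil c, fun w => rfl⟩
  | succ n ih =>
    obtain ⟨v, hv, hunstable⟩ :=
      exists_unstable_of_isAllowedOn (by rintro rfl; simp at hn) hc ha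
    obtain ⟨h, rfl⟩ : ∃ h', h = h' + Pi.single v 1 :=
      ⟨h - Pi.single v 1, (tsub_add_cancel_of_le fun w => by
        by_cases hw : w = v
        · subst hw
          simpa using Nat.one_le_iff_ne_zero.2 hv
        · simp [hw]).symm⟩
    obtain ⟨l, hl, hcount⟩ := ih (a := G.topple a v) (h := h)
      (hc.mono fun w hw => by simp_all) (fun w => by
        have hcast : (fun u => (((h + Pi.single v 1 : W → ℕ) u : ℕ) : ℤ)) =
            (fun u => (h u : ℤ)) + Pi.single v 1 := by
          funext u
          simp [Pi.single_apply]
        rw [ha, G.cast_topple hunstable, hcast, mulVec_add, mulVec_single_one, Pi.add_apply,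
          col_apply]
        ring) (by simpa [Finset.sum_add_distrib] using hn)
    refine ⟨v :: l, .cons hunstable hl, fun w => ?_⟩
    simp [List.count_cons, hcount, Pi.single_apply, eq_comm (a := v)]

theorem isTopplingVector_iff {f : W → ℕ} :
    G.IsTopplingVector a f ↔ (∀ w, a w - (G.laplacian *ᵥ (f ·)) w < G.deg w) ∧
      G.IsAllowedOn (fun w => a w - (G.laplacian *ᵥ (f ·)) w) {w | f w ≠ 0} := by
  constructor
  · rintro ⟨l, c, hl, hc, hf⟩
    obtain rfl : f = (l.count ·) := funext hf
    refine ⟨fun w => ?_, (isAllowedOn_congr fun w _ => hl.cast_eq w).1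
      (hl.isAllowedOn.mono fun w hw => ?_)⟩
    · rw [← hl.cast_eq]
      exact_mod_cast hc w
    · simpa [List.count_eq_zero] using hw
  · rintro ⟨hstable, hallowed⟩
    have hnonneg (w : W) : 0 ≤ a w - (G.laplacian *ᵥ (f ·)) w := by
      by_cases hw : f w = 0
      · rw [laplacian_mulVec_apply, hw]
        have : 0 ≤ ∑ u, (G.weight (some w) (some u) : ℤ) * f u := by positivity
        push_cast
        linarith [(a w).cast_nonneg (α := ℤ)]
      · exact hallowed.nonneg (by simpa using hw)
    choose c hc using fun w => Int.eq_ofNat_of_zero_le (hnonneg w)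
    simp only [hc] at hstable hallowed
    obtain ⟨l, hl, hcount⟩ := exists_topples_of_isAllowedOn hallowed fun w => (hc w).symm
    exact ⟨l, c, hl, fun w => by exact_mod_cast hstable w, fun w => (hcount w).symm⟩

/-! ### Recurrent sandpiles -/

theorem isAllowedOn_univ_of_stabilizes (h : G.Stabilizes a c) (ha : ∀ w, G.deg w ≤ a w) :
    G.IsAllowedOn (c ·) Finset.univ := by
  obtain ⟨⟨l, hl⟩, hc⟩ := h
  refine hl.isAllowedOn.mono fun w _ => List.mem_toFinset.2 ?_
  by_contra hw
  exact (hc w).not_ge ((ha w).trans (G.le_of_topples hl hw))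

theorem IsAllowedOn.exists_topples (hc : G.IsAllowedOn (c ·) Finset.univ) {z : W → ℤ}
    (hz : 0 ≤ z) (ha : ∀ w, (a w : ℤ) = c w + (G.laplacian *ᵥ z) w) :
    ∃ l, G.Topples a l c ∧ ∀ w, (l.count w : ℤ) = z w := by
  lift z to W → ℕ using hz
  obtain ⟨l, hl, hcount⟩ := exists_topples_of_isAllowedOn (hc.mono (Finset.subset_univ _))
    fun w => eq_sub_of_add_eq (ha w).symm
  exact ⟨l, hl, fun w => by rw [hcount]⟩

theorem exists_le_and_le_laplacian (G : SinkGraph W) (x y : W → ℤ) :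
    ∃ z, x ≤ z ∧ y ≤ G.laplacian *ᵥ z := by
  obtain ⟨p, hp, hlap⟩ := G.exists_potential
  have hone (w : W) : 1 ≤ (G.laplacian *ᵥ p) w := by
    rw [laplacian_mulVec_apply]
    linarith [hlap w]
  have hp_one (w : W) : 1 ≤ p w := by
    have hsum : 0 ≤ ∑ u, (G.weight (some w) (some u) : ℤ) * p u :=
      Finset.sum_nonneg fun u _ => mul_nonneg (by positivity) (hp u)
    exact pos_of_mul_pos_right (hsum.trans_lt (hlap w)) (by positivity)
  obtain ⟨N, hN⟩ := Finite.exists_le (fun w => max 0 (max (x w) (y w)))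
  refine ⟨N • p, fun w => ?_, fun w => ?_⟩
  · have := hN w
    rw [Pi.smul_apply, smul_eq_mul]
    nlinarith [hp_one w, le_max_left 0 (max (x w) (y w)), le_max_right 0 (max (x w) (y w)),
      le_max_left (x w) (y w)]
  · have := hN w
    rw [mulVec_smul, Pi.smul_apply, smul_eq_mul]
    nlinarith [hone w, le_max_left 0 (max (x w) (y w)), le_max_right 0 (max (x w) (y w)),
      le_max_right (x w) (y w)]

theorem isRecurrent_iff :
    G.IsRecurrent c ↔ G.IsStable c ∧ G.IsAllowedOn (c ·) Finset.univ := by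
  refine and_congr_right fun hstable => ⟨fun h => ?_, fun h a => ?_⟩
  · obtain ⟨b, hb⟩ := h G.deg
    exact isAllowedOn_univ_of_stabilizes hb fun w => Nat.le_add_right _ _
  · obtain ⟨z, hz, hle⟩ := G.exists_le_and_le_laplacian 0 (a ·)
    have hb (w : W) : 0 ≤ c w + (G.laplacian *ᵥ z) w - a w := by
      linarith [hle w, (c w).cast_nonneg (α := ℤ)]
    choose b hb using fun w => Int.eq_ofNat_of_zero_le (hb w)
    obtain ⟨l, hl, -⟩ := h.exists_topples (a := a + b) hz fun w => by
      rw [Pi.add_apply, Nat.cast_add, ← hb]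
      ring
    exact ⟨b, ⟨l, hl⟩, hstable⟩

theorem existsUnique_isRecurrent (G : SinkGraph W) (a : W → ℤ) :
    ∃! c, G.IsRecurrent c ∧ ∃ z, ∀ w, (c w : ℤ) = a w + (G.laplacian *ᵥ z) w := by
  refine existsUnique_of_exists_of_unique ?_ ?_
  · obtain ⟨z, -, hle⟩ := G.exists_le_and_le_laplacian 0 fun w => G.deg w - a w
    have hdeg (w : W) : G.deg w ≤ a w + (G.laplacian *ᵥ z) w := by linarith [hle w]
    choose b hb using fun w => Int.eq_ofNat_of_zero_le ((G.deg w).cast_nonneg.trans (hdeg w))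
    obtain ⟨l, c, hl, hc⟩ := G.exists_stabilizes b
    refine ⟨c, isRecurrent_iff.2 ⟨hc, isAllowedOn_univ_of_stabilizes ⟨⟨l, hl⟩, hc⟩ fun w => ?_⟩,
      z - fun u => (l.count u : ℤ), fun w => ?_⟩
    · exact_mod_cast hb w ▸ hdeg w
    · rw [hl.cast_eq, ← hb, mulVec_sub, Pi.sub_apply]
      ring
  · rintro c c' ⟨hc, z, hz⟩ ⟨hc', z', hz'⟩
    obtain ⟨q, hq, hle⟩ := G.exists_le_and_le_laplacian (z ⊔ z') (-a)
    have hb (w : W) : 0 ≤ a w + (G.laplacian *ᵥ q) w := by linarith [hle w, Pi.neg_apply a w]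
    choose b hb using fun w => Int.eq_ofNat_of_zero_le (hb w)
    rw [isRecurrent_iff] at hc hc'
    obtain ⟨l, hl, -⟩ := hc.2.exists_topples (a := b) (z := q - z)
      (sub_nonneg.2 (le_sup_left.trans hq)) fun w => by
        rw [← hb, hz, mulVec_sub, Pi.sub_apply]
        ring
    obtain ⟨l', hl', -⟩ := hc'.2.exists_topples (a := b) (z := q - z')
      (sub_nonneg.2 (le_sup_right.trans hq)) fun w => by
        rw [← hb, hz', mulVec_sub, Pi.sub_apply]
        ring
    exact hl.eq_of_isStable hl' hc.1 hc'.1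

/-! ### Principal avalanches -/

variable {v : W}

theorem isTopplingVector_ite_iff {T : Finset W} :
    G.IsTopplingVector a (fun w => if w ∈ T then 1 else 0) ↔
      (∀ w ∈ T, a w + G.weightTo w T < 2 * G.deg w) ∧
      (∀ w ∉ T, a w + G.weightTo w T < G.deg w) ∧
      G.IsAllowedOn (fun w => a w + G.weightTo w T - G.deg w) T := by
  have hz (w : W) : (a w : ℤ) - (G.laplacian *ᵥ fun u => ((if u ∈ T then 1 else 0 : ℕ) : ℤ)) w =
      a w + G.weightTo w T - if w ∈ T then (G.deg w : ℤ) else 0 := by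
    simp only [Nat.cast_ite, Nat.cast_one, Nat.cast_zero, laplacian_mulVec_ite]
    ring
  have hsupport : ({w | (if w ∈ T then 1 else 0) ≠ 0} : Finset W) = T := by simp
  simp only [isTopplingVector_iff, hz, hsupport]
  rw [← and_assoc]
  refine and_congr ⟨fun h => ⟨fun w hw => ?_, fun w hw => ?_⟩, fun h w => ?_⟩
    (isAllowedOn_congr fun w hw => by rw [if_pos hw])
  · have := h w
    rw [if_pos hw] at this
    omega
  · have := h w
    rw [if_neg hw] at this
    omega
  · split_ifs with hw
    · have := h.1 w hw
      omega
    · have := h.2 w hw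
      omega

theorem nu_eq_iff {f : W → ℕ} : G.nu c v = f ↔ G.IsTopplingVector (c + Pi.single v 1) f :=
  have h := (G.existsUnique_topplingVector (c + Pi.single v 1)).choose_spec
  ⟨fun hf => hf ▸ h.1, fun hf => (h.2 f hf).symm⟩

/-- Adding to `c` one grain along each edge at the sink makes every vertex topple exactly once and
leads back to `c`. When `v` is adjacent to the sink, these grains include the one added at `v`. -/
theorem nu_le_one (hc : G.IsRecurrent c) (hv : 0 < G.weight (some v) none) (w : W) :
    G.nu c v w ≤ 1 := by
  rw [isRecurrent_iff] at hc
  let sinkEdges : W → ℕ := fun u => G.weight (some u) none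
  obtain ⟨l, hl, hcount⟩ := hc.2.exists_topples (a := c + sinkEdges) zero_le_one fun u => by
    have hlap := G.laplacian_mulVec_ite Finset.univ u
    simp only [Finset.mem_univ, if_true] at hlap
    rw [Pi.one_def, hlap, G.deg_eq_weight_sink_add, Pi.add_apply]
    push_cast
    ring
  obtain ⟨l', c', hl', -, hnu⟩ := nu_eq_iff.1 (rfl : G.nu c v = _)
  have hle : Pi.single v 1 ≤ sinkEdges := fun u => by
    by_cases huv : u = v
    · subst huv
      simpa using Nat.succ_le_of_lt hv
    · simp [huv]
  have hl'' := hl'.add_right (sinkEdges - Pi.single v 1)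
  rw [add_assoc, add_tsub_cancel_of_le hle] at hl''
  calc G.nu c v w = l'.count w := hnu w
    _ ≤ l.count w := G.topples_count_le hl'' hl hc.1 w
    _ = 1 := Nat.cast_injective (hcount w)

variable (G c v) in
/-- The set of the vertices that topple in the principal avalanche of `c` at `v`. -/
noncomputable def toppled : Finset W := {w | 0 < G.nu c v w}

theorem mem_toppled {w : W} : w ∈ G.toppled c v ↔ 0 < G.nu c v w :=
  Finset.mem_filter_univ _

theorem self_mem_toppled (hc : G.IsStable c) (h : (G.toppled c v).Nonempty) :
    v ∈ G.toppled c v := by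
  obtain ⟨l, c', hl, -, hcount⟩ := nu_eq_iff.1 (rfl : G.nu c v = _)
  obtain ⟨w, hw⟩ := h
  rw [mem_toppled, hcount] at hw ⊢
  cases hl with
  | nil => simp at hw
  | @cons _ _ u l hu =>
    have huv : u = v := by
      by_contra huv
      exact (hc u).not_ge (by simpa [huv] using hu)
    simp [huv]

theorem nu_eq_ite (hc : G.IsRecurrent c) (hv : 0 < G.weight (some v) none) (w : W) :
    G.nu c v w = if w ∈ G.toppled c v then 1 else 0 := by
  have := nu_le_one hc hv w
  simp only [mem_toppled]
  split_ifs <;> omega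

theorem avalancheSize_eq_card_toppled (hc : G.IsRecurrent c) (hv : 0 < G.weight (some v) none) :
    G.avalancheSize c v = (G.toppled c v).card := by
  simp [avalancheSize, nu_eq_ite hc hv]

theorem toppled_eq_iff (hc : G.IsRecurrent c) (hv : 0 < G.weight (some v) none) {T : Finset W} :
    G.toppled c v = T ↔
      G.IsTopplingVector (c + Pi.single v 1) fun w => if w ∈ T then 1 else 0 := by
  rw [← nu_eq_iff]
  constructor
  · rintro rfl
    exact funext (nu_eq_ite hc hv)
  · intro h
    ext w
    by_cases hw : w ∈ T <;> simp [mem_toppled, h, hw]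

variable {J : Finset W}

theorem toppled_eq_insert_iff (hc : G.IsRecurrent c) (hv : 0 < G.weight (some v) none)
    (hvJ : v ∉ J) :
    G.toppled c v = insert v J ↔ c v + 1 = G.deg v ∧
      G.IsAllowedOn (fun w => c w + G.weightTo w (insert v J) - G.deg w) J ∧
      ∀ w ∉ insert v J, c w + G.weightTo w (insert v J) < G.deg w := by
  set T := insert v J with hT
  have hvT : v ∈ T := Finset.mem_insert_self v J
  let a : W → ℕ := c + Pi.single v 1
  have hav : a v = c v + 1 := by simp [a]
  have ha (w : W) (hw : w ≠ v) : a w = c w := by simp [a, hw]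
  have haJ (w : W) (hw : w ∈ J) : a w = c w := ha w (ne_of_mem_of_not_mem hw hvJ)
  have hstable : ∀ w ∈ T, a w + G.weightTo w T < 2 * G.deg w := fun w hw => by
    have := hc.1 w
    rcases Finset.mem_insert.1 hw with rfl | hwJ
    · have := weightTo_lt_deg hv T
      omega
    · have := haJ w hwJ
      have := G.weightTo_le_deg w T
      omega
  have hstable' : (∀ w ∉ T, a w + G.weightTo w T < G.deg w) ↔
      ∀ w ∉ T, c w + G.weightTo w T < G.deg w :=
    forall₂_congr fun w hw => by rw [ha w fun h => hw (h ▸ hvT)]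
  have hlt (w : W) (hw : w ∈ J) : (a w + G.weightTo w T - G.deg w : ℤ) < G.weightTo w T := by
    have := hc.1 w
    have := haJ w hw
    omega
  have hfull : (G.weightTo v T : ℤ) ≤ a v + G.weightTo v T - G.deg v ↔ c v + 1 = G.deg v := by
    have := hc.1 v
    omega
  rw [toppled_eq_iff hc hv, isTopplingVector_ite_iff, and_iff_right hstable, hstable',
    isAllowedOn_insert_iff hvJ hlt, hfull, and_comm, and_assoc]
  exact and_congr_right' (and_congr_left' (isAllowedOn_congr fun w hw => by rw [haJ w hw]))

theorem deg_le_add_weightTo_toppled (hc : G.IsRecurrent c) (hv : 0 < G.weight (some v) none)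
    {w : W} (hw : w ∈ G.toppled c v) (hwv : w ≠ v) :
    G.deg w ≤ c w + G.weightTo w (G.toppled c v) := by
  have hinsert := Finset.insert_erase (self_mem_toppled hc.1 ⟨w, hw⟩)
  have hallowed :=
    ((toppled_eq_insert_iff hc hv (Finset.notMem_erase v _)).1 hinsert.symm).2.1
  have hnonneg := hallowed.nonneg (Finset.mem_erase.2 ⟨hwv, hw⟩)
  rw [hinsert] at hnonneg
  omega

theorem isRecurrent_of_isAllowedOn (hv : 0 < G.weight (some v) none) (hcv : c v + 1 = G.deg v)
    (hstable : ∀ w ∈ J, c w < G.deg w)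
    (hJ : G.IsAllowedOn (fun w => c w + G.weightTo w (insert v J) - G.deg w) J)
    (hstable' : ∀ w ∉ insert v J, c w < G.deg w)
    (hcompl : G.IsAllowedOn (c ·) (insert v J)ᶜ) : G.IsRecurrent c := by
  refine isRecurrent_iff.2 ⟨fun w => ?_, fun S _ hne => ?_⟩
  · by_cases hwT : w ∈ insert v J
    · rcases Finset.mem_insert.1 hwT with rfl | hwJ
      · omega
      · exact hstable w hwJ
    · exact hstable' w hwT
  · by_cases hvS : v ∈ S
    · have := weightTo_lt_deg hv S
      exact ⟨v, hvS, by dsimp only; omega⟩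
    rcases (S ∩ J).eq_empty_or_nonempty with hSJ | hSJ
    · refine hcompl S (fun w hw => ?_) hne
      have hwJ : w ∉ J := fun hwJ => Finset.notMem_empty w (hSJ ▸ Finset.mem_inter_of_mem hw hwJ)
      simp [hwJ, ne_of_mem_of_not_mem hw hvS]
    · obtain ⟨w, hw, hle⟩ := hJ _ Finset.inter_subset_right hSJ
      have hsub : S ⊆ S ∩ J ∪ (insert v J)ᶜ := fun u hu => by
        have := ne_of_mem_of_not_mem hu hvS
        by_cases huJ : u ∈ J <;> simp [hu, huJ, this]
      have hunion : G.weightTo w (S ∩ J ∪ (insert v J)ᶜ) ≤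
          G.weightTo w (S ∩ J) + G.weightTo w (insert v J)ᶜ :=
        le_of_add_le_left (Finset.sum_union_inter (M := ℕ)).le
      have hcompl : G.weightTo w (insert v J) + G.weightTo w (insert v J)ᶜ =
          G.weightTo w Finset.univ := Finset.sum_add_sum_compl _ _
      have := weightTo_mono (G := G) (w := w) hsub
      have := G.weightTo_le_deg w Finset.univ
      exact ⟨w, Finset.mem_of_mem_inter_left hw, by dsimp only at hle ⊢; omega⟩

theorem isRecurrent_and_toppled_eq_insert_iff (hv : 0 < G.weight (some v) none) (hvJ : v ∉ J) :
    G.IsRecurrent c ∧ G.toppled c v = insert v J ↔ c v + 1 = G.deg v ∧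
      ((∀ w ∈ J, c w < G.deg w) ∧
        G.IsAllowedOn (fun w => c w + G.weightTo w (insert v J) - G.deg w) J) ∧
      (∀ w ∉ insert v J, c w + G.weightTo w (insert v J) < G.deg w) ∧
        G.IsAllowedOn (c ·) (insert v J)ᶜ := by
  constructor
  · rintro ⟨hc, htoppled⟩
    obtain ⟨hcv, hJ, hstable⟩ := (toppled_eq_insert_iff hc hv hvJ).1 htoppled
    exact ⟨hcv, ⟨fun w _ => hc.1 w, hJ⟩, hstable,
      (isRecurrent_iff.1 hc).2.mono (Finset.subset_univ _)⟩
  · rintro ⟨hcv, ⟨hstable, hJ⟩, hstable', hcompl⟩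
    have hc : G.IsRecurrent c := isRecurrent_of_isAllowedOn hv hcv hstable hJ
      (fun w hw => (Nat.le_add_right _ _).trans_lt (hstable' w hw)) hcompl
    exact ⟨hc, (toppled_eq_insert_iff hc hv hvJ).2 ⟨hcv, hJ, hstable'⟩⟩

end SinkGraph

/-! ### Symmetry of the avalanche polynomial -/

theorem sum_C_mul_prod_X_eq_sum_esymm {R σ : Type*} [Field R] [CharZero R] [Fintype σ]
    {a : Finset σ → R} (ha : ∀ S T, S.card = T.card → a S = a T) :
    ∑ T, MvPolynomial.C (a T) * ∏ i ∈ T, MvPolynomial.X i =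
      ∑ m ∈ Finset.range (Fintype.card σ + 1),
        MvPolynomial.C ((∑ T ∈ Finset.univ.powersetCard m, a T) / (Fintype.card σ).choose m) *
          MvPolynomial.esymm σ R m := by
  rw [← Finset.powerset_univ, Finset.sum_powerset]
  refine Finset.sum_congr rfl fun m hm => ?_
  rw [MvPolynomial.esymm, Finset.mul_sum]
  refine Finset.sum_congr rfl fun T hT => ?_
  have hconst : ∑ S ∈ Finset.univ.powersetCard m, a S = (Fintype.card σ).choose m * a T := by
    rw [Finset.sum_congr rfl fun S hS => ha S T <| by
      rw [(Finset.mem_powersetCard.1 hS).2, (Finset.mem_powersetCard.1 hT).2]]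
    simp [Finset.card_powersetCard]
  have hchoose : ((Fintype.card σ).choose m : R) ≠ 0 :=
    Nat.cast_ne_zero.2 (Nat.choose_pos (Finset.mem_range_succ_iff.1 hm)).ne'
  rw [hconst, mul_div_cancel_left₀ _ hchoose]

namespace SinkGraph

variable {W W' : Type*} [Fintype W] [Fintype W'] {G : SinkGraph W} {H : SinkGraph W'}
  {e : W ≃ W'}

theorem deg_apply_equiv (he : ∀ u v, H.weight (u.map e) (v.map e) = G.weight u v) (v : W) :
    H.deg (e v) = G.deg v := by
  rw [deg, ← e.optionCongr.sum_comp]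
  exact Finset.sum_congr rfl fun u _ => he (some v) u

variable [DecidableEq W] [DecidableEq W']

theorem Topples.map_equiv (he : ∀ u v, H.weight (u.map e) (v.map e) = G.weight u v)
    {a c : W → ℕ} {l : List W} (h : G.Topples a l c) :
    H.Topples (a ∘ e.symm) (l.map e) (c ∘ e.symm) := by
  induction h with
  | nil c => exact .nil _
  | @cons a c v l hv _ ih =>
    refine .cons (by simpa [deg_apply_equiv he] using hv) ?_
    convert ih using 1
    funext w'
    obtain ⟨w, rfl⟩ := e.surjective w'
    have hw := he (some v) (some w)
    simp only [Option.map_some] at hw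
    simp [topple, hw, deg_apply_equiv he]

theorem isRecurrent_comp_equiv_symm
    (he : ∀ u v, H.weight (u.map e) (v.map e) = G.weight u v) {c : W → ℕ} :
    H.IsRecurrent (c ∘ e.symm) ↔ G.IsRecurrent c := by
  rw [isRecurrent_iff, isRecurrent_iff, ← Finset.map_univ_equiv e,
    isAllowedOn_map e.toEmbedding fun u v => he (some u) (some v)]
  simp [IsStable, e.surjective.forall, deg_apply_equiv he, Function.comp_def]

theorem nu_comp_equiv_symm (he : ∀ u v, H.weight (u.map e) (v.map e) = G.weight u v)
    (c : W → ℕ) (v : W) :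
    H.nu (c ∘ e.symm) (e v) = G.nu c v ∘ e.symm := by
  obtain ⟨l, c', hl, hstable, hcount⟩ := nu_eq_iff.1 (rfl : G.nu c v = _)
  refine nu_eq_iff.2 ⟨l.map e, c' ∘ e.symm, ?_, fun w' => ?_, fun w' => ?_⟩
  · convert hl.map_equiv he using 1
    funext w'
    simp [Pi.single_apply, Equiv.symm_apply_eq]
  · obtain ⟨w, rfl⟩ := e.surjective w'
    simpa [deg_apply_equiv he] using hstable w
  · obtain ⟨w, rfl⟩ := e.surjective w'
    simp [hcount, List.count_map_of_injective _ _ e.injective]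

theorem toppled_comp_equiv_symm
    (he : ∀ u v, H.weight (u.map e) (v.map e) = G.weight u v) (c : W → ℕ) (v : W) :
    H.toppled (c ∘ e.symm) (e v) = (G.toppled c v).map e.toEmbedding := by
  ext w'
  obtain ⟨w, rfl⟩ := e.surjective w'
  simp [mem_toppled, nu_comp_equiv_symm he]

variable (G) in
/-- The principal avalanches in which exactly the vertices in `T` topple, given by pairs `(c, v)`
as in `SinkGraph.avalanches`. -/
noncomputable def avalanchesOn (T : Finset W) : Finset ((W → ℕ) × W) :=
  (G.recurrents ×ˢ Finset.univ).filter fun p => G.toppled p.1 p.2 = T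

theorem mem_avalanchesOn {T : Finset W} {p : (W → ℕ) × W} :
    p ∈ G.avalanchesOn T ↔ G.IsRecurrent p.1 ∧ G.toppled p.1 p.2 = T := by
  simp [avalanchesOn, mem_recurrents]

theorem card_avalanchesOn_map (he : ∀ u v, H.weight (u.map e) (v.map e) = G.weight u v)
    (T : Finset W) :
    (H.avalanchesOn (T.map e.toEmbedding)).card = (G.avalanchesOn T).card := by
  refine (Finset.card_equiv ((e.arrowCongr (Equiv.refl ℕ)).prodCongr e) fun p => ?_).symm
  change _ ↔ (p.1 ∘ e.symm, e p.2) ∈ _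
  rw [mem_avalanchesOn, mem_avalanchesOn, isRecurrent_comp_equiv_symm he,
    toppled_comp_equiv_symm he, Finset.map_inj]

theorem mem_avalanches (hG : ∀ v, 0 < G.weight (some v) none) {m : ℕ}
    {p : (W → ℕ) × W} :
    p ∈ G.avalanches m ↔ G.IsRecurrent p.1 ∧ (G.toppled p.1 p.2).card = m := by
  rw [avalanches, Finset.mem_filter, Finset.mem_product, mem_recurrents,
    and_iff_left (Finset.mem_univ _)]
  exact and_congr_right fun hp => by rw [avalancheSize_eq_card_toppled hp (hG _)]

theorem avalancheCount_eq_sum (hG : ∀ v, 0 < G.weight (some v) none) (m : ℕ) :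
    G.avalancheCount m = ∑ T ∈ Finset.univ.powersetCard m, (G.avalanchesOn T).card := by
  rw [avalancheCount, Finset.card_eq_sum_card_fiberwise (f := fun p => G.toppled p.1 p.2)
    (t := Finset.univ.powersetCard m) fun p hp => by
      simpa using ((mem_avalanches hG).1 hp).2]
  refine Finset.sum_congr rfl fun T hT => congrArg _ ?_
  ext p
  rw [Finset.mem_filter, mem_avalanches hG, mem_avalanchesOn, and_assoc]
  refine and_congr_right fun _ => and_iff_right_of_imp ?_
  rintro rfl
  exact (Finset.mem_powersetCard.1 hT).2

theorem avalanchePolynomial_eq_sum (hG : ∀ v, 0 < G.weight (some v) none) :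
    G.avalanchePolynomial =
      ∑ T, MvPolynomial.C ((G.avalanchesOn T).card : ℚ) * ∏ i ∈ T, MvPolynomial.X i := by
  have hmonomial : ∀ p ∈ G.recurrents ×ˢ (Finset.univ : Finset W),
      ∏ i, (MvPolynomial.X i : MvPolynomial W ℚ) ^ G.nu p.1 p.2 i =
        ∏ i ∈ G.toppled p.1 p.2, MvPolynomial.X i := fun p hp => by
    have hp := G.mem_recurrents.1 (Finset.mem_product.1 hp).1
    simp [nu_eq_ite hp (hG _), pow_ite, Finset.prod_ite_mem]
  rw [avalanchePolynomial, ← Finset.sum_product', Finset.sum_congr rfl hmonomial,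
    ← Finset.sum_fiberwise _ fun p => G.toppled p.1 p.2]
  refine Finset.sum_congr rfl fun T _ => ?_
  rw [Finset.sum_congr rfl fun p hp => by rw [(Finset.mem_filter.1 hp).2], Finset.sum_const,
    nsmul_eq_mul, map_natCast]
  rfl

theorem avalanchePolynomial_eq_sum_esymm (hG : ∀ v, 0 < G.weight (some v) none)
    (hsymm : ∀ (σ : Equiv.Perm W) (u v : Option W),
      G.weight (u.map σ) (v.map σ) = G.weight u v) :
    G.avalanchePolynomial = ∑ m ∈ Finset.range (Fintype.card W + 1),
      MvPolynomial.C ((G.avalancheCount m : ℚ) / (Fintype.card W).choose m) *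
        MvPolynomial.esymm W ℚ m := by
  have hcard (S T : Finset W) (h : S.card = T.card) :
      ((G.avalanchesOn S).card : ℚ) = (G.avalanchesOn T).card := by
    let e : {x // x ∈ S} ≃ {x // x ∈ T} := Finset.equivOfCardEq h
    have hmap : S.map e.extendSubtype.toEmbedding = T := by
      refine Finset.eq_of_subset_of_card_le (fun x hx => ?_) (by simp [h])
      obtain ⟨y, hy, rfl⟩ := Finset.mem_map.1 hx
      exact e.extendSubtype_mem y hy
    rw [← hmap, card_avalanchesOn_map (hsymm _)]
  rw [avalanchePolynomial_eq_sum hG, sum_C_mul_prod_X_eq_sum_esymm hcard]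
  simp only [avalancheCount_eq_sum hG, Nat.cast_sum]

end SinkGraph

namespace completeSink

open SinkGraph Matrix

variable {k n m : ℕ}

/-! ### Recurrent sandpiles on complete graphs -/

theorem weight_none_pos (v : Fin k) : 0 < (completeSink k).weight (some v) none := by
  simp [completeSink]

theorem deg_eq (v : Fin k) : (completeSink k).deg v = k := by
  simp [deg, completeSink, Finset.sum_ite, Finset.filter_ne]

theorem weightTo_eq (w : Fin k) (S : Finset (Fin k)) :
    (completeSink k).weightTo w S = (S.erase w).card := by
  simp [weightTo, completeSink, Finset.sum_ite, Finset.filter_ne]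

theorem laplacian_mulVec (z : Fin k → ℤ) (w : Fin k) :
    ((completeSink k).laplacian *ᵥ z) w = (k + 1) * z w - ∑ u, z u := by
  have hsum : ∑ u, ((completeSink k).weight (some w) (some u) : ℤ) * z u = ∑ u, z u - z w := by
    simp [completeSink, Finset.sum_ite, Finset.filter_ne, Finset.sum_erase_eq_sub]
  rw [laplacian_mulVec_apply, deg_eq, hsum]
  ring

theorem exists_eq_add_laplacian_iff {a b : Fin k → ℤ} :
    (∃ z, ∀ w, b w = a w + ((completeSink k).laplacian *ᵥ z) w) ↔
      ∃ t : ZMod (k + 1), ∀ w, (b w : ZMod (k + 1)) = a w + t := by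
  simp only [laplacian_mulVec]
  constructor
  · rintro ⟨z, hz⟩
    refine ⟨-((∑ u, z u : ℤ) : ZMod (k + 1)), fun w => ?_⟩
    have hk : ((k : ZMod (k + 1)) + 1) = 0 := by exact_mod_cast ZMod.natCast_self (k + 1)
    rw [hz]
    push_cast
    rw [hk]
    ring
  · rintro ⟨t, ht⟩
    obtain ⟨t, rfl⟩ := ZMod.intCast_surjective t
    have hdvd (w : Fin k) : ((k + 1 : ℕ) : ℤ) ∣ b w - (a w + t) := by
      rw [← ZMod.intCast_eq_intCast_iff_dvd_sub, ht]
      push_cast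
      rfl
    choose y hy using hdvd
    refine ⟨fun w => y w + (t + ∑ u, y u), fun w => ?_⟩
    have hyw := hy w
    simp only [Finset.sum_add_distrib, Finset.sum_const, Finset.card_univ, Fintype.card_fin,
      nsmul_eq_mul]
    push_cast at hyw ⊢
    linear_combination hyw

theorem card_recurrents_mul (k : ℕ) :
    (completeSink k).recurrents.card * (k + 1) = (k + 1) ^ k := by
  let shift (p : {c // c ∈ (completeSink k).recurrents} × ZMod (k + 1)) (w : Fin k) :
      ZMod (k + 1) := (p.1.1 w : ZMod (k + 1)) + p.2
  have hshift : Function.Bijective shift := by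
    constructor
    · rintro ⟨⟨c, hc⟩, t⟩ ⟨⟨c', hc'⟩, t'⟩ h
      replace h (w : Fin k) : (c w : ZMod (k + 1)) + t = c' w + t' := congrFun h w
      have hcc' : c = c' := ((completeSink k).existsUnique_isRecurrent fun w => c w).unique
        ⟨(mem_recurrents _).1 hc, 0, by simp⟩
        ⟨(mem_recurrents _).1 hc', exists_eq_add_laplacian_iff.2
          ⟨t - t', fun w => by push_cast; linear_combination -h w⟩⟩
      subst hcc'
      have ht : t = t' := by
        cases k with
        | zero => exact Subsingleton.elim (α := ZMod 1) t t'
        | succ k => exact add_left_cancel (h 0)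
      rw [ht]
    · intro x
      choose a ha using fun w => ZMod.intCast_surjective (x w)
      obtain ⟨c, ⟨hc, hz⟩, -⟩ := (completeSink k).existsUnique_isRecurrent a
      obtain ⟨t, ht⟩ := exists_eq_add_laplacian_iff.1 hz
      refine ⟨⟨⟨c, (mem_recurrents _).2 hc⟩, -t⟩, funext fun w => ?_⟩
      have htw := ht w
      push_cast at htw
      simp [shift, htw, ha]
  simpa [ZMod.card] using Fintype.card_congr (Equiv.ofBijective shift hshift)

theorem isRecurrent_iff_isAllowedOn {J : Finset (Fin n)} (hJ : J.card = k) {c : Fin k → ℕ}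
    {z : Fin n → ℤ} (hz : ∀ i, z (J.orderEmbOfFin hJ i) = c i) :
    (completeSink k).IsRecurrent c ↔ (∀ w ∈ J, z w < k) ∧ (completeSink n).IsAllowedOn z J := by
  have hmap : Finset.univ.map (J.orderEmbOfFin hJ).toEmbedding = J := J.map_orderEmbOfFin_univ hJ
  have hcomp : z ∘ (J.orderEmbOfFin hJ).toEmbedding = fun i => (c i : ℤ) := funext hz
  rw [isRecurrent_iff, ← hmap, isAllowedOn_map (G := completeSink k) _ fun u v => by
    simp [completeSink], hcomp]
  simp only [IsStable, deg_eq, Finset.forall_mem_map, Finset.mem_univ, forall_const,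
    RelEmbedding.coe_toEmbedding, hz, Nat.cast_lt]

/-! ### The avalanche bijection -/

theorem isRecurrent_and_toppled_eq_iff {v : Fin n} {J : Finset (Fin n)} (hvJ : v ∉ J)
    (hm : J.card + 1 = m) (hJ : J.card = m - 1) (hK : (insert v J)ᶜ.card = n - m)
    {c : Fin n → ℕ} {c₁ : Fin (m - 1) → ℕ} {c₂ : Fin (n - m) → ℕ}
    (h₁ : ∀ i, c (J.orderEmbOfFin hJ i) = c₁ i + (n - m + 1))
    (h₂ : ∀ i, c ((insert v J)ᶜ.orderEmbOfFin hK i) = c₂ i) :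
    (completeSink n).IsRecurrent c ∧ (completeSink n).toppled c v = insert v J ↔
      c v + 1 = n ∧ (completeSink (m - 1)).IsRecurrent c₁ ∧
        (completeSink (n - m)).IsRecurrent c₂ := by
  have hcard : (insert v J).card = m := by rw [Finset.card_insert_of_notMem hvJ, hm]
  have hmn : m ≤ n := by simpa [hcard] using Finset.card_le_univ (insert v J)
  have hweight (w : Fin n) (hw : w ∈ insert v J) :
      (completeSink n).weightTo w (insert v J) + 1 = m := by
    rw [weightTo_eq, Finset.card_erase_add_one hw, hcard]
  have hweight' (w : Fin n) (hw : w ∉ insert v J) :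
      (completeSink n).weightTo w (insert v J) = m := by
    rw [weightTo_eq, Finset.erase_eq_of_notMem hw, hcard]
  rw [isRecurrent_and_toppled_eq_insert_iff (weight_none_pos v) hvJ,
    isRecurrent_iff_isAllowedOn hJ (z := fun w =>
      c w + (completeSink n).weightTo w (insert v J) - (completeSink n).deg w) fun i => by
        have := hweight _ (Finset.mem_insert_of_mem (J.orderEmbOfFin_mem hJ i))
        have := h₁ i
        rw [deg_eq]
        omega,
    isRecurrent_iff_isAllowedOn hK (z := (c ·)) fun i => by rw [h₂]]
  simp only [deg_eq, Finset.mem_compl]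
  refine and_congr_right' (and_congr (and_congr_left' (forall₂_congr fun w hw => ?_))
    (and_congr_left' (forall₂_congr fun w hw => ?_)))
  · have := hweight w (Finset.mem_insert_of_mem hw)
    omega
  · have := hweight' w hw
    omega

theorem mem_avalanches_and_isPhi_iff {t : AvalancheTuple n m} {c : Fin n → ℕ} {v : Fin n} :
    (c, v) ∈ (completeSink n).avalanches m ∧ t.IsPhi c v ↔ t.v = v ∧ c v + 1 = n ∧
      (∀ i, c (t.J.orderEmbOfFin t.card_J_eq i) = t.c₁ i + (n - m + 1)) ∧
      ∀ i, c ((insert t.v t.J)ᶜ.orderEmbOfFin t.card_compl i) = t.c₂ i := by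
  have hm := t.card_J
  have hfilter : Finset.univ.filter (fun w => w ≠ v ∧ 0 < (completeSink n).nu c v w) =
      ((completeSink n).toppled c v).erase v := by
    ext w
    simp [mem_toppled]
  have hiff := isRecurrent_and_toppled_eq_iff (c := c) (c₁ := t.c₁) (c₂ := t.c₂) t.notMem hm
    t.card_J_eq t.card_compl
  rw [mem_avalanches weight_none_pos, AvalancheTuple.IsPhi, hfilter]
  constructor
  · rintro ⟨⟨hc, hcard⟩, rfl, hJ, h₁, h₂⟩
    dsimp only at hc hcard
    have hpos : 0 < ((completeSink n).toppled c t.v).card := by omega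
    have hv := self_mem_toppled hc.1 (Finset.card_pos.1 hpos)
    refine ⟨rfl, ((hiff h₁ h₂).1 ⟨hc, ?_⟩).1, h₁, h₂⟩
    rw [hJ, Finset.insert_erase hv]
  · rintro ⟨rfl, hcv, h₁, h₂⟩
    obtain ⟨hc, htoppled⟩ := (hiff h₁ h₂).2 ⟨hcv, t.rec₁, t.rec₂⟩
    rw [htoppled, Finset.erase_insert t.notMem, Finset.card_insert_of_notMem t.notMem]
    exact ⟨⟨hc, hm⟩, rfl, rfl, h₁, h₂⟩

theorem exists_isPhi (hm : 1 ≤ m) {c : Fin n → ℕ} {v : Fin n}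
    (h : (c, v) ∈ (completeSink n).avalanches m) : ∃ t : AvalancheTuple n m, t.IsPhi c v := by
  obtain ⟨hc, hcard⟩ := (mem_avalanches weight_none_pos).1 h
  dsimp only at hc hcard
  have hv := self_mem_toppled hc.1 (Finset.card_pos.1 (hm.trans_eq hcard.symm))
  obtain ⟨T, hT⟩ : ∃ T, (completeSink n).toppled c v = T := ⟨_, rfl⟩
  rw [hT] at hcard hv
  have hinsert : insert v (T.erase v) = T := Finset.insert_erase hv
  have hm' : (T.erase v).card + 1 = m := by rw [Finset.card_erase_add_one hv, hcard]
  have hJ : (T.erase v).card = m - 1 := by omega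
  have hmn : m ≤ n := by simpa [hcard] using Finset.card_le_univ T
  have hK : (insert v (T.erase v))ᶜ.card = n - m := by
    rw [hinsert, Finset.card_compl, hcard, Fintype.card_fin]
  have hle (w : Fin n) (hw : w ∈ T.erase v) : n - m + 1 ≤ c w := by
    obtain ⟨hne, hwT⟩ := Finset.mem_erase.1 hw
    have hdeg := deg_le_add_weightTo_toppled hc (weight_none_pos v) (hT ▸ hwT) hne
    have hweight := Finset.card_erase_add_one hwT
    rw [hT, deg_eq, weightTo_eq] at hdeg
    omega
  choose c₁ h₁ using fun i =>
    Nat.exists_eq_add_of_le' (hle _ ((T.erase v).orderEmbOfFin_mem hJ i))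
  obtain ⟨hcv, rec₁, rec₂⟩ := (isRecurrent_and_toppled_eq_iff (Finset.notMem_erase v T) hm' hJ hK
    h₁ fun _ => rfl).1 ⟨hc, hT.trans hinsert.symm⟩
  let t : AvalancheTuple n m := ⟨v, T.erase v, Finset.notMem_erase v T, hm', c₁, _, rec₁, rec₂⟩
  exact ⟨t, ((mem_avalanches_and_isPhi_iff (t := t)).2 ⟨rfl, hcv, h₁, fun _ => rfl⟩).2⟩

theorem existsUnique_isPhi (hm : 1 ≤ m) {c : Fin n → ℕ} {v : Fin n}
    (h : (c, v) ∈ (completeSink n).avalanches m) : ∃! t : AvalancheTuple n m, t.IsPhi c v := by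
  refine existsUnique_of_exists_of_unique (exists_isPhi hm h) ?_
  rintro ⟨v₁, J, _, _, c₁, c₂, _, _⟩ ⟨v₁', J', _, _, c₁', c₂', _, _⟩ ⟨hv, hJ, h₁, h₂⟩
    ⟨hv', hJ', h₁', h₂'⟩
  obtain rfl : v₁ = v₁' := hv.trans hv'.symm
  obtain rfl : J = J' := hJ.trans hJ'.symm
  obtain rfl : c₁ = c₁' := funext fun i => Nat.add_right_cancel ((h₁ i).symm.trans (h₁' i))
  obtain rfl : c₂ = c₂' := funext fun i => (h₂ i).symm.trans (h₂' i)
  rfl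

theorem existsUnique_avalanche (t : AvalancheTuple n m) :
    ∃! p : (Fin n → ℕ) × Fin n, p ∈ (completeSink n).avalanches m ∧ t.IsPhi p.1 p.2 := by
  let J := t.J.orderEmbOfFin t.card_J_eq
  let K := (insert t.v t.J)ᶜ.orderEmbOfFin t.card_compl
  have hvJ (i) : J i ≠ t.v := ne_of_mem_of_not_mem (t.J.orderEmbOfFin_mem _ i) t.notMem
  have hK (i) : K i ≠ t.v ∧ K i ∉ t.J := by
    have hi := Finset.mem_compl.1 ((insert t.v t.J)ᶜ.orderEmbOfFin_mem t.card_compl i)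
    rwa [Finset.mem_insert, not_or] at hi
  refine existsUnique_of_exists_of_unique
    ⟨(Function.extend J (t.c₁ · + (n - m + 1)) (Function.extend K t.c₂ fun _ => n - 1), t.v),
      mem_avalanches_and_isPhi_iff.2 ⟨rfl, ?_, fun i => ?_, fun i => ?_⟩⟩ ?_
  · have hn := t.v.pos
    rw [Function.extend_apply' _ _ _ fun ⟨i, hi⟩ => hvJ i hi,
      Function.extend_apply' _ _ _ fun ⟨i, hi⟩ => (hK i).1 hi]
    omega
  · exact J.injective.extend_apply _ _ i
  · rw [Function.extend_apply' _ _ _ fun ⟨j, hj⟩ =>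
      (hK i).2 (hj ▸ t.J.orderEmbOfFin_mem t.card_J_eq j)]
    exact K.injective.extend_apply _ _ i
  · rintro ⟨c, v⟩ ⟨c', v'⟩ h h'
    obtain ⟨rfl, hv, h₁, h₂⟩ := mem_avalanches_and_isPhi_iff.1 h
    obtain ⟨rfl, hv', h₁', h₂'⟩ := mem_avalanches_and_isPhi_iff.1 h'
    refine Prod.ext (funext fun w => ?_) rfl
    by_cases hw : w ∈ insert t.v t.J
    · rcases Finset.mem_insert.1 hw with rfl | hwJ
      · exact Nat.add_right_cancel (hv.trans hv'.symm)
      · obtain ⟨i, rfl⟩ : w ∈ Set.range J := by simpa [J] using hwJ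
        exact (h₁ i).trans (h₁' i).symm
    · obtain ⟨i, rfl⟩ : w ∈ Set.range K := by simpa [K, and_comm] using hw
      exact (h₂ i).trans (h₂' i).symm

theorem exists_equiv_isPhi (hm : 1 ≤ m) :
    ∃ φ : {p : (Fin n → ℕ) × Fin n // p ∈ (completeSink n).avalanches m} ≃
      AvalancheTuple n m, ∀ p, (φ p).IsPhi p.1.1 p.1.2 := by
  choose φ hφ hφ_unique using fun p : {p // p ∈ (completeSink n).avalanches m} =>
    existsUnique_isPhi hm p.2
  refine ⟨Equiv.ofBijective φ ⟨fun p q hpq => ?_, fun t => ?_⟩, hφ⟩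
  · exact Subtype.ext ((existsUnique_avalanche (φ p)).unique ⟨p.2, hφ p⟩ ⟨q.2, hpq ▸ hφ q⟩)
  · obtain ⟨p, ⟨hp, ht⟩, -⟩ := existsUnique_avalanche t
    exact ⟨⟨p, hp⟩, (hφ_unique ⟨p, hp⟩ t ht).symm⟩

/-! ### Counting avalanches -/

/-- An `AvalancheTuple` is a vertex, a set avoiding it and two recurrent sandpiles; this turns
the number of tuples into a product. -/
def tupleEquiv (hm : 1 ≤ m) : AvalancheTuple n m ≃
    (Σ v : Fin n, {J // J ∈ Finset.powersetCard (m - 1) (Finset.univ.erase v)}) ×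
      {c // c ∈ (completeSink (m - 1)).recurrents} ×
      {c // c ∈ (completeSink (n - m)).recurrents} where
  toFun t := ⟨⟨t.v, t.J, Finset.mem_powersetCard.2
      ⟨Finset.subset_erase.2 ⟨Finset.subset_univ _, t.notMem⟩, t.card_J_eq⟩⟩,
    ⟨t.c₁, (mem_recurrents _).2 t.rec₁⟩, ⟨t.c₂, (mem_recurrents _).2 t.rec₂⟩⟩
  invFun x :=
    have hJ := Finset.mem_powersetCard.1 x.1.2.2
    { v := x.1.1
      J := x.1.2.1
      notMem := (Finset.subset_erase.1 hJ.1).2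
      card_J := by rw [hJ.2, Nat.sub_add_cancel hm]
      c₁ := x.2.1.1
      c₂ := x.2.2.1
      rec₁ := (mem_recurrents _).1 x.2.1.2
      rec₂ := (mem_recurrents _).1 x.2.2.2 }
  left_inv _ := rfl
  right_inv _ := rfl

theorem avalancheCount_eq_mul_card_recurrents (hm : 1 ≤ m) :
    (completeSink n).avalancheCount m = n * (n - 1).choose (m - 1) *
      ((completeSink (m - 1)).recurrents.card * (completeSink (n - m)).recurrents.card) := by
  obtain ⟨φ, -⟩ := exists_equiv_isPhi (n := n) hm
  have hcard := Nat.card_congr (φ.trans (tupleEquiv hm))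
  rw [Nat.card_eq_fintype_card, Nat.card_eq_fintype_card] at hcard
  simpa only [avalancheCount, Fintype.card_prod, Fintype.card_sigma, Fintype.card_coe,
    Finset.card_powersetCard, Finset.card_erase_of_mem (Finset.mem_univ _), Finset.card_univ,
    Fintype.card_fin, Finset.sum_const, smul_eq_mul] using hcard

theorem card_recurrents (k : ℕ) :
    ((completeSink k).recurrents.card : ℚ) = (k + 1 : ℚ) ^ ((k : ℤ) - 1) := by
  have hne : (k + 1 : ℚ) ≠ 0 := by positivity
  rw [zpow_sub_one₀ hne, zpow_natCast, eq_mul_inv_iff_mul_eq₀ hne]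
  exact_mod_cast card_recurrents_mul k

theorem avalancheCount_eq (hm : 1 ≤ m) (hmn : m ≤ n) :
    ((completeSink n).avalancheCount m : ℚ) =
      (n.choose m : ℚ) * (m : ℚ) ^ (m - 1) *
        ((n : ℚ) - (m : ℚ) + 1) ^ ((n : ℤ) - (m : ℤ) - 1) := by
  obtain ⟨m, rfl⟩ := Nat.exists_eq_add_of_le' hm
  obtain ⟨d, rfl⟩ := Nat.exists_eq_add_of_le' hmn
  have hcard : ((completeSink d).recurrents.card : ℚ) =
      (((d + (m + 1) : ℕ) : ℚ) - ((m + 1 : ℕ) : ℚ) + 1) ^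
        (((d + (m + 1) : ℕ) : ℤ) - ((m + 1 : ℕ) : ℤ) - 1) := by
    rw [card_recurrents]
    push_cast
    simp only [add_sub_cancel_right]
  rw [← hcard, avalancheCount_eq_mul_card_recurrents hm, Nat.add_sub_cancel, Nat.add_sub_cancel]
  norm_cast
  calc (d + (m + 1)) * (d + m).choose m *
        ((completeSink m).recurrents.card * (completeSink d).recurrents.card)
      = (d + m + 1) * (d + m).choose m * (completeSink m).recurrents.card *
          (completeSink d).recurrents.card := by ring
    _ = (d + (m + 1)).choose (m + 1) * ((completeSink m).recurrents.card * (m + 1)) *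
          (completeSink d).recurrents.card := by
      rw [Nat.add_one_mul_choose_eq (d + m) m, ← add_assoc]
      ring
    _ = (d + (m + 1)).choose (m + 1) * (m + 1) ^ m * (completeSink d).recurrents.card := by
      rw [card_recurrents_mul]

end completeSink

theorem mainTheorem2 (n : ℕ) :
    (completeSink n).avalanchePolynomial =
        ∑ m ∈ Finset.range (n + 1),
          MvPolynomial.C (((completeSink n).avalancheCount m : ℚ) / (n.choose m : ℚ)) *
            MvPolynomial.esymm (Fin n) ℚ m ∧
      ∀ m : ℕ, 1 ≤ m → m ≤ n →
        (∃ φ : {p : (Fin n → ℕ) × Fin n // p ∈ (completeSink n).avalanches m} ≃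
            AvalancheTuple n m, ∀ p, (φ p).IsPhi p.1.1 p.1.2) ∧
        ((completeSink n).avalancheCount m : ℚ) =
          (n.choose m : ℚ) * (m : ℚ) ^ (m - 1) *
            ((n : ℚ) - (m : ℚ) + 1) ^ ((n : ℤ) - (m : ℤ) - 1) := by
  refine ⟨?_, fun m hm hmn =>
    ⟨completeSink.exists_equiv_isPhi hm, completeSink.avalancheCount_eq hm hmn⟩⟩
  have hsymm (σ : Equiv.Perm (Fin n)) (u v : Option (Fin n)) :
      (completeSink n).weight (u.map σ) (v.map σ) = (completeSink n).weight u v := by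
    simp [completeSink, (Option.map_injective σ.injective).eq_iff]
  simpa using SinkGraph.avalanchePolynomial_eq_sum_esymm completeSink.weight_none_pos hsymm
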